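/- Let $G$ be a finite group and let $\Bbbk$ be an algebraically closed field of characteristic $p$, where $p$ divides $|G|$. For a finite-dimensional representation $V$ of $G$ over $\Bbbk$, let $\Bbbk[V]$ be the ring of polynomial functions $V\to\Bbbk$, on which $G$ acts by $(g\cdot f)(v)=f(g^{-1}v)$, let $\Bbbk[V]^G$ be the ring of invariants, and let $\Bbbk[V]^G_{\le d}$ be the set of invariants of degree at most $d$. For $S\subseteq\Bbbk[V]$ let $S_+$ be the set of $f\in S$ with constant term zero, and let $\mathcal N_{G,V}=\{v\in V : f(v)=0 \text{ for all } f\in\Bbbk[V]^G_+\}$ be the nullcone. Let $\sigma(G,V)$ be the least $d\ge 0$ such that for every $v\in V\setminus\mathcal N_{G,V}$ there is an $f\in(\Bbbk[V]^G_{\le d})_+$ with $f(v)\ne 0$, and let $\sigma(G)=\sup_V\sigma(G,V)$, the supremum over all finite-dimensional representations $V$ of $G$ over $\Bbbk$. Theorem 1.2. Let $P$ be a Sylow $p$-subgroup of $G$ with normalizer $N_G(P)$, and let $l$ be the smallest prime divisor of $|G|$. Then the following hold. (a) If $\sigma(G)=|G|$, then $N_G(P)/P$ is cyclic. If additionally $P$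 is abelian and $G\ne P$, then $N_G(P)/P$ is also non-trivial. (b) If $N_G(P)/P$ is cyclic, then $\sigma(G)\ge |N_G(P)|$. In particular, $\sigma(G)=|G|$ when $P$ is normal in $G$ and $G/P$ is cyclic. (c) If $G$ is $p$-nilpotent (that is, a Sylow $p$-subgroup of $G$ has a normal complement) and $P$ is not normal in $G$, then $\sigma(G)\le |G|/l$. -/

import Mathlib

namespace ZeroSep

section

variable {k G V : Type*} [Field k] [Group G] [AddCommGroup V] [Module k V]

/-- `f : V → k` is a polynomial function of degree at most `d`: a polynomial expression of total
degree at most `d` in linear forms on `V`. -/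
def IsPolyFunLE (d : ℕ) (f : V → k) : Prop :=
  ∃ F : MvPolynomial (Module.Dual k V) k,
    F.totalDegree ≤ d ∧ ∀ v : V, f v = MvPolynomial.eval (fun φ => φ v) F

/-- The set `k[V]^G_{≤ d}` of invariant polynomial functions of degree at most `d`, where `G` acts
on functions by `(g • f) v = f (g⁻¹ v)`. -/
def invariantsLE (ρ : Representation k G V) (d : ℕ) : Set (V → k) :=
  {f | IsPolyFunLE d f ∧ ∀ (g : G) (v : V), f (ρ g⁻¹ v) = f v}

/-- The ring of invariants `k[V]^G`, as a set of functions. -/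
def invariants (ρ : Representation k G V) : Set (V → k) :=
  {f | ∃ d, f ∈ invariantsLE ρ d}

/-- The elements of `S` with constant term zero (the constant term of `f` is `f 0`). -/
def plusPart (S : Set (V → k)) : Set (V → k) :=
  {f ∈ S | f 0 = 0}

/-- The nullcone of `V`. -/
def nullcone (ρ : Representation k G V) : Set V :=
  {v | ∀ f ∈ plusPart (invariants ρ), f v = 0}

/-- A set `S` of invariants is a `σ`-set if for every `v` outside the nullcone some element of
`S` with zero constant term does not vanish at `v`. -/
def IsSigmaSet (ρ : Representation k G V) (S : Set (V → k)) : Prop :=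
  S ⊆ invariants ρ ∧ ∀ v : V, v ∉ nullcone ρ → ∃ f ∈ plusPart S, f v ≠ 0

/-- `σ(G, V)`: the least `d` such that `k[V]^G_{≤ d}` is a `σ`-set (infinite if there is none). -/
noncomputable def sigmaRep (ρ : Representation k G V) : ℕ∞ :=
  ⨅ (d : ℕ) (_ : IsSigmaSet ρ (invariantsLE ρ d)), (d : ℕ∞)

end

/-- `σ(G)`: the supremum of `σ(G, V)` over all finite-dimensional representations `V` of `G` over
`k`. It is enough to let `V` run over the spaces `k ^ n`: see `sigmaRep_le_sigma`. -/
noncomputable def sigma (k G : Type*) [Field k] [Group G] : ℕ∞ :=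
  ⨆ (n : ℕ) (ρ : Representation k G (Fin n → k)), sigmaRep ρ

section

variable {k G V W : Type*} [Field k] [Group G] [AddCommGroup V] [Module k V]
  [AddCommGroup W] [Module k W]

theorem IsPolyFunLE.comp_linear {d : ℕ} {f : W → k} (hf : IsPolyFunLE d f) (e : V →ₗ[k] W) :
    IsPolyFunLE d (fun v => f (e v)) := by
  obtain ⟨F, hF, h⟩ := hf
  refine ⟨MvPolynomial.rename (fun φ : Module.Dual k W => φ.comp e) F,
    (MvPolynomial.totalDegree_rename_le _ _).trans hF, fun v => ?_⟩
  rw [MvPolynomial.eval_rename]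
  exact h (e v)

theorem comp_mem_invariantsLE {ρ : Representation k G V} {τ : Representation k G W}
    (e : V →ₗ[k] W) (he : ∀ g v, e (ρ g v) = τ g (e v)) {d : ℕ} {f : W → k}
    (hf : f ∈ invariantsLE τ d) : (fun v => f (e v)) ∈ invariantsLE ρ d :=
  ⟨hf.1.comp_linear e, fun g v => by simp only [he]; exact hf.2 g (e v)⟩

/-- `σ(G, V)` depends only on the isomorphism class of `V`. -/
theorem sigmaRep_le_of_equiv (ρ : Representation k G V) (τ : Representation k G W)
    (e : V ≃ₗ[k] W) (he : ∀ g v, e (ρ g v) = τ g (e v)) : sigmaRep ρ ≤ sigmaRep τ := by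
  have he' : ∀ g w, e.symm (τ g w) = ρ g (e.symm w) := fun g w => by
    rw [LinearEquiv.symm_apply_eq, he, LinearEquiv.apply_symm_apply]
  refine le_iInf₂ fun d hd => iInf₂_le d ⟨fun f hf => ⟨d, hf⟩, fun v hv => ?_⟩
  have hv' : e v ∉ nullcone τ := by
    intro h
    refine hv fun f hf => ?_
    obtain ⟨⟨m, hm⟩, h0⟩ := hf
    have := h (fun w => f (e.symm w))
      ⟨⟨m, comp_mem_invariantsLE e.symm.toLinearMap he' hm⟩, by simpa using h0⟩
    simpa using this
  obtain ⟨f, ⟨hf, h0⟩, hfv⟩ := hd.2 (e v) hv'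
  exact ⟨fun v => f (e v), ⟨comp_mem_invariantsLE e.toLinearMap he hf, by simpa using h0⟩, hfv⟩

/-- `σ(G)` bounds `σ(G, V)` for every finite-dimensional representation `V`, in any universe. -/
theorem sigmaRep_le_sigma [FiniteDimensional k V] (ρ : Representation k G V) :
    sigmaRep ρ ≤ sigma k G := by
  let e : V ≃ₗ[k] (Fin (Module.finrank k V) → k) := (Module.finBasis k V).equivFun
  let τ : Representation k G (Fin (Module.finrank k V) → k) :=
    { toFun := fun g => e.toLinearMap ∘ₗ ρ g ∘ₗ e.symm.toLinearMap
      map_one' := by ext; simp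
      map_mul' := fun g h => by ext; simp }
  exact (sigmaRep_le_of_equiv ρ τ e fun g v => by simp [τ]).trans
    (le_iSup₂ (f := fun (n : ℕ) (ρ : Representation k G (Fin n → k)) => sigmaRep ρ) _ τ)

end

/-- A group is `p`-nilpotent if it has a Sylow `p`-subgroup with a normal complement. -/
def IsPNilpotent (p : ℕ) (G : Type*) [Group G] : Prop :=
  ∃ (P : Sylow p G) (H : Subgroup G), H.Normal ∧ H.IsComplement' (P : Subgroup G)

/-- The quotient group `N_G(P) / P`. -/
abbrev NormalizerQuotient {G : Type*} [Group G] (P : Subgroup G) : Type _ :=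
  Subgroup.normalizer (P : Set G) ⧸ P.subgroupOf (Subgroup.normalizer (P : Set G))

end ZeroSep

/-!
For a finite group `G` the norm of a linear form shows `σ(G) ≤ |G|`; in particular the nullcone
is zero, and `σ(G) ≤ d` says that invariants of degree at most `d` without constant term separate
every nonzero vector from zero (`ZeroSeparates`, `sigma_le_iff`). Norms of `H`-invariants give
`σ(G) ≤ [G : H] σ(H)`, and composing invariants gives `σ(G) ≤ σ(N) σ(G / N)`. Hence, if a
subquotient `B` of `G` satisfies `r σ(B) ≤ |B|` for some prime divisor `r` of `|B|`, then so does
`G` (`SavesPrime`).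

There are two sources of such subquotients. A non-cyclic abelian group of order prime to the
characteristic has `σ ≤ exponent`, because powers of eigenforms are invariants. A non-abelian
extension of `ℤ/r` by `ℤ/q` with `q` prime to the characteristic (but `r` arbitrary) has `σ ≤ q`
(`zeroSeparates_of_metacyclic`): given a vector, one takes a monomial in the translates of an
eigenform that involves exactly the translates not vanishing at the vector and whose weight is
zero; the other monomials of its orbit vanish at the vector, and a pigeonhole argument in `ℤ/q`
keeps the degree at most `q` (`exists_zero_sum_of_injOn`).

Every non-cyclic group of order prime to `p` has one of these subquotients
(`savesPrime_of_not_isCyclic`). If `N_G(P)/P` is not cyclic, this applies to it, and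
`σ(G) < |G|` follows. If `P` has a normal complement `H` but is not normal, then either `H` is not
cyclic, or `P` acts non-trivially on a subgroup of prime order of the cyclic group `H`, which again
yields a subquotient of the second kind (`savesPrime_of_isPNilpotent`). If `P` is abelian and
self-normalizing, such a complement exists by Burnside's transfer theorem.

For the lower bound, a faithful character of the cyclic group `N_G(P)/P` is inflated to `N_G(P)`
and extended by zero to a vector of the space of functions on `G`. A homogeneous invariant that is
nonzero there has degree divisible by the order of the character and, since only monomials fixed
by `P` contribute in characteristic `p`, by `|P|` (`ZeroSeparates.exists_card_dvd`).
-/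

namespace ZeroSep

/-! ### Polynomial functions -/

section PolyFun

variable {k V : Type*} [Field k] [AddCommGroup V] [Module k V]

theorem IsPolyFunLE.mono {d e : ℕ} {f : V → k} (hf : IsPolyFunLE d f) (h : d ≤ e) :
    IsPolyFunLE e f := by
  obtain ⟨F, hF, hf⟩ := hf
  exact ⟨F, hF.trans h, hf⟩

theorem isPolyFunLE_const (c : k) : IsPolyFunLE 0 (fun _ : V => c) :=
  ⟨MvPolynomial.C c, by simp, by simp⟩

theorem isPolyFunLE_linear (φ : V →ₗ[k] k) : IsPolyFunLE 1 (fun v => φ v) :=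
  ⟨MvPolynomial.X (R := k) (φ : Module.Dual k V), by simp, by simp⟩

theorem IsPolyFunLE.add {d : ℕ} {f g : V → k} (hf : IsPolyFunLE d f) (hg : IsPolyFunLE d g) :
    IsPolyFunLE d (fun v => f v + g v) := by
  obtain ⟨F, hF, hf⟩ := hf
  obtain ⟨F', hF', hg⟩ := hg
  exact ⟨F + F', (MvPolynomial.totalDegree_add _ _).trans (max_le hF hF'), by simp [hf, hg]⟩

theorem IsPolyFunLE.mul {d e : ℕ} {f g : V → k} (hf : IsPolyFunLE d f) (hg : IsPolyFunLE e g) :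
    IsPolyFunLE (d + e) (fun v => f v * g v) := by
  obtain ⟨F, hF, hf⟩ := hf
  obtain ⟨F', hF', hg⟩ := hg
  exact ⟨F * F', (MvPolynomial.totalDegree_mul _ _).trans (add_le_add hF hF'), by simp [hf, hg]⟩

theorem IsPolyFunLE.pow {d : ℕ} {f : V → k} (hf : IsPolyFunLE d f) (n : ℕ) :
    IsPolyFunLE (n * d) (fun v => f v ^ n) := by
  induction n with
  | zero => simpa using isPolyFunLE_const (V := V) (1 : k)
  | succ n ih => simpa only [pow_succ, Nat.succ_mul] using ih.mul hf

theorem IsPolyFunLE.sum {ι : Type*} {d : ℕ} (s : Finset ι) {f : ι → V → k}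
    (hf : ∀ i ∈ s, IsPolyFunLE d (f i)) : IsPolyFunLE d (fun v => ∑ i ∈ s, f i v) := by
  classical
  induction s using Finset.induction_on with
  | empty => simpa using (isPolyFunLE_const (V := V) (0 : k)).mono (Nat.zero_le d)
  | insert a s ha ih =>
    simp only [Finset.sum_insert ha]
    exact (hf a (by simp)).add (ih fun i hi => hf i (by simp [hi]))

theorem IsPolyFunLE.prod {ι : Type*} (s : Finset ι) {d : ι → ℕ} {f : ι → V → k}
    (hf : ∀ i ∈ s, IsPolyFunLE (d i) (f i)) :
    IsPolyFunLE (∑ i ∈ s, d i) (fun v => ∏ i ∈ s, f i v) := by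
  classical
  induction s using Finset.induction_on with
  | empty => simpa using isPolyFunLE_const (V := V) (1 : k)
  | insert a s ha ih =>
    simp only [Finset.prod_insert ha, Finset.sum_insert ha]
    exact (hf a (by simp)).mul (ih fun i hi => hf i (by simp [hi]))

theorem dual_apply_eq_sum {ι : Type*} [Fintype ι] [DecidableEq ι] (φ : Module.Dual k (ι → k))
    (w : ι → k) : φ w = ∑ i, φ (Pi.single i 1) * w i := by
  conv_lhs => rw [← Finset.univ_sum_single w, map_sum]
  refine Finset.sum_congr rfl fun i _ => ?_
  rw [mul_comm, ← smul_eq_mul, ← map_smul, ← Pi.single_smul, smul_eq_mul, mul_one]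

/-- Composition of polynomial functions multiplies degree bounds. -/
theorem IsPolyFunLE.comp {W : Type*} [AddCommGroup W] [Module k W] {d e : ℕ} {f : W → k}
    (hf : IsPolyFunLE e f) (Φ : V → W)
    (hΦ : ∀ φ : Module.Dual k W, IsPolyFunLE d (fun v => φ (Φ v))) :
    IsPolyFunLE (d * e) (fun v => f (Φ v)) := by
  obtain ⟨F, hF, hf⟩ := hf
  simp only [hf, MvPolynomial.eval_eq]
  refine IsPolyFunLE.sum _ fun m hm => ?_
  have hdeg : (∑ φ ∈ m.support, m φ) * d ≤ d * e := by
    rw [mul_comm]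
    exact Nat.mul_le_mul_left _ ((MvPolynomial.le_totalDegree hm).trans hF)
  refine IsPolyFunLE.mono ?_ hdeg
  rw [Finset.sum_mul, ← zero_add (∑ φ ∈ m.support, m φ * d)]
  exact (isPolyFunLE_const _).mul (IsPolyFunLE.prod _ fun φ _ => (hΦ φ).pow _)

end PolyFun

/-! ### Separating vectors from zero; subgroups and quotients -/

section Separation

variable {k G V : Type*} [Field k] [Group G] [AddCommGroup V] [Module k V]

theorem invariantsLE_mono (ρ : Representation k G V) {d e : ℕ} (h : d ≤ e) :
    invariantsLE ρ d ⊆ invariantsLE ρ e := fun _ hf => ⟨hf.1.mono h, hf.2⟩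

theorem apply_eq_of_mem_invariantsLE {ρ : Representation k G V} {d : ℕ} {f : V → k}
    (hf : f ∈ invariantsLE ρ d) (g : G) (v : V) : f (ρ g v) = f v := by
  simpa using hf.2 g⁻¹ v

theorem mem_invariantsLE_of_apply_eq {ρ : Representation k G V} {d : ℕ} {f : V → k}
    (hf : IsPolyFunLE d f) (h : ∀ g v, f (ρ g v) = f v) : f ∈ invariantsLE ρ d :=
  ⟨hf, fun g v => h g⁻¹ v⟩

/-- The invariants of degree at most `d` with zero constant term, as a subspace of the space of
all functions. -/
def plusInvariants (ρ : Representation k G V) (d : ℕ) : Submodule k (V → k) where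
  carrier := plusPart (invariantsLE ρ d)
  zero_mem' := ⟨⟨(isPolyFunLE_const (0 : k)).mono (Nat.zero_le d), fun _ _ => rfl⟩, rfl⟩
  add_mem' := fun {f f'} hf hf' => ⟨⟨hf.1.1.add hf'.1.1, fun g v => by
    simp only [Pi.add_apply, hf.1.2 g v, hf'.1.2 g v]⟩, by
    simp only [Pi.add_apply, hf.2, hf'.2, add_zero]⟩
  smul_mem' := fun c f hf => ⟨⟨((isPolyFunLE_const (V := V) c).mul hf.1.1).mono
    (Nat.zero_add d).le, fun g v => by
    simp only [Pi.smul_apply, hf.1.2 g v]⟩, by simp only [Pi.smul_apply, hf.2, smul_zero]⟩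

/-- If finitely many points can each be separated from zero by some function in a linear space of
functions, then one function of that space does so at all of them: over an infinite field a space
is not a finite union of proper subspaces. -/
theorem exists_mem_forall_apply_ne_zero [Infinite k] {X ι : Type*} [Finite ι]
    (U : Submodule k (X → k)) (x : ι → X) (h : ∀ i, ∃ f ∈ U, f (x i) ≠ 0) :
    ∃ f ∈ U, ∀ i, f (x i) ≠ 0 := by
  classical
  have := Fintype.ofFinite ι
  let K (i : ι) : Subspace k U :=
    LinearMap.ker ((LinearMap.proj (x i) : (X → k) →ₗ[k] k) ∘ₗ U.subtype)
  have key : ⋃ p ∈ Finset.univ.image K, (p : Set U) ≠ Set.univ := by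
    refine Subspace.biUnion_ne_univ_of_top_notMem fun hK => ?_
    obtain ⟨i, -, hi⟩ := Finset.mem_image.1 hK
    obtain ⟨f, hf, hfx⟩ := h i
    have hmem : (⟨f, hf⟩ : U) ∈ K i := hi ▸ Submodule.mem_top
    exact hfx (by simpa [K] using hmem)
  obtain ⟨f, hf⟩ := (Set.ne_univ_iff_exists_notMem _).1 key
  exact ⟨f, f.2, fun i hi => hf <| Set.mem_biUnion
    (Finset.mem_coe.2 <| Finset.mem_image_of_mem K (Finset.mem_univ i)) (by simpa [K] using hi)⟩

variable (k G) in
/-- Every nonzero vector of every finite-dimensional representation of `G` over `k` is separated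
from zero by an invariant of degree at most `d`. For finite `G` this says `σ(G) ≤ d`, see
`sigma_le_iff`. -/
def ZeroSeparates (d : ℕ) : Prop :=
  ∀ (n : ℕ) (ρ : Representation k G (Fin n → k)) (v : Fin n → k), v ≠ 0 →
    ∃ f ∈ plusInvariants ρ d, f v ≠ 0

theorem ZeroSeparates.mono {d e : ℕ} (h : ZeroSeparates k G d) (hde : d ≤ e) :
    ZeroSeparates k G e := fun n ρ v hv => by
  obtain ⟨f, hf, hfv⟩ := h n ρ v hv
  exact ⟨f, ⟨invariantsLE_mono ρ hde hf.1, hf.2⟩, hfv⟩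

theorem ZeroSeparates.exists_mem [FiniteDimensional k V] {d : ℕ} (h : ZeroSeparates k G d)
    (ρ : Representation k G V) {v : V} (hv : v ≠ 0) : ∃ f ∈ plusInvariants ρ d, f v ≠ 0 := by
  let e : V ≃ₗ[k] (Fin (Module.finrank k V) → k) := (Module.finBasis k V).equivFun
  let τ : Representation k G (Fin (Module.finrank k V) → k) :=
    { toFun := fun g => e.toLinearMap ∘ₗ ρ g ∘ₗ e.symm.toLinearMap
      map_one' := by ext; simp
      map_mul' := fun g h => by ext; simp }
  obtain ⟨f, hf, hfv⟩ := h _ τ (e v) (by simpa using hv)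
  exact ⟨fun v => f (e v), ⟨comp_mem_invariantsLE e.toLinearMap (fun g v => by simp [τ]) hf.1,
    by simpa using hf.2⟩, hfv⟩

theorem ZeroSeparates.sigma_le {d : ℕ} (h : ZeroSeparates k G d) : sigma k G ≤ d := by
  refine iSup₂_le fun n ρ => iInf₂_le d ⟨fun f hf => ⟨d, hf⟩, fun v hv => ?_⟩
  refine h n ρ v ?_
  rintro rfl
  exact hv fun f hf => hf.2

theorem ZeroSeparates.bot : ZeroSeparates k (⊥ : Subgroup G) 1 := fun n ρ v hv => by
  obtain ⟨i, hi⟩ := Function.ne_iff.1 hv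
  refine ⟨fun v => v i, ⟨mem_invariantsLE_of_apply_eq
    (isPolyFunLE_linear (LinearMap.proj i : (Fin n → k) →ₗ[k] k)) fun g v => ?_, rfl⟩, hi⟩
  obtain rfl : g = 1 := Subsingleton.elim _ _
  simp

/-- `σ(G) ≤ [G : H] σ(H)`, by taking norms of `H`-invariants. -/
theorem ZeroSeparates.of_subgroup [Infinite k] [Finite G] (H : Subgroup G) {d : ℕ}
    (h : ZeroSeparates k H d) : ZeroSeparates k G (H.index * d) := fun n ρ v hv => by
  classical
  have := Fintype.ofFinite (G ⧸ H)
  let τ : Representation k H (Fin n → k) := ρ.comp H.subtype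
  have hinj (g : G) : ρ g v ≠ 0 := fun h0 => hv <| by simpa using congrArg (ρ g⁻¹) h0
  obtain ⟨f, hf, hfv⟩ := exists_mem_forall_apply_ne_zero (plusInvariants τ d)
    (fun g : G => ρ g v) fun g => h n τ _ (hinj g)
  let F : G ⧸ H → (Fin n → k) → k := fun c w => f (ρ c.out⁻¹ w)
  have hF (g : G) (w : Fin n → k) : F g w = f (ρ g⁻¹ w) := by
    obtain ⟨x, hx⟩ := QuotientGroup.mk_out_eq_mul H g
    have := apply_eq_of_mem_invariantsLE hf.1 x⁻¹ (ρ g⁻¹ w)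
    simp only [F, hx, mul_inv_rev]
    rw [← this]
    simp [τ]
  refine ⟨fun w => ∏ c, F c w, ⟨mem_invariantsLE_of_apply_eq ?_ fun g w => ?_, ?_⟩, ?_⟩
  · have := IsPolyFunLE.prod (d := fun _ => d) Finset.univ (f := F)
      fun c _ => hf.1.1.comp_linear (ρ c.out⁻¹)
    simpa [Subgroup.index, Nat.card_eq_fintype_card] using this
  · rw [← Equiv.prod_comp (MulAction.toPerm g) fun c => F c (ρ g w)]
    refine Finset.prod_congr rfl fun c _ => ?_
    induction c using QuotientGroup.induction_on with
    | H x =>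
      have : MulAction.toPerm g (x : G ⧸ H) = ((g * x : G) : G ⧸ H) := rfl
      rw [this, hF, hF, ← Module.End.mul_apply, ← map_mul]
      simp
  · have h0 : ∀ c, F c 0 = 0 := fun c => by simpa [F] using hf.2
    exact Finset.prod_eq_zero (Finset.mem_univ ((1 : G) : G ⧸ H)) (h0 _)
  · exact Finset.prod_ne_zero_iff.2 fun c _ => hfv _

/-- Noether's bound: the norm of a linear form. -/
theorem zeroSeparates_card [Infinite k] [Finite G] : ZeroSeparates k G (Nat.card G) := by
  simpa using ZeroSeparates.of_subgroup ⊥ (ZeroSeparates.bot (k := k) (G := G))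

theorem sigma_le_iff [Infinite k] [Finite G] {d : ℕ} : sigma k G ≤ d ↔ ZeroSeparates k G d := by
  refine ⟨fun h n ρ v hv => ?_, ZeroSeparates.sigma_le⟩
  have h1 := (sigmaRep_le_sigma ρ).trans h
  obtain ⟨e, he, hed⟩ : ∃ e, IsSigmaSet ρ (invariantsLE ρ e) ∧ e ≤ d := by
    by_contra! hcon
    have h2 : ((d + 1 : ℕ) : ℕ∞) ≤ sigmaRep ρ :=
      le_iInf₂ fun e he => by exact_mod_cast hcon e he
    exact absurd (h2.trans h1) (by norm_cast; simp)
  -- the nullcone is zero by Noether's bound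
  obtain ⟨f, hf, hfv⟩ := zeroSeparates_card n ρ v hv
  obtain ⟨f', hf', hfv'⟩ := he.2 v fun hnull => hfv (hnull f ⟨⟨_, hf.1⟩, hf.2⟩)
  exact ⟨f', ⟨invariantsLE_mono ρ hed hf'.1, hf'.2⟩, hfv'⟩

variable (k G) in
/-- The left translation action of `G` on the space of functions `G → k`. -/
def translationRep : Representation k G (G → k) where
  toFun g := LinearMap.funLeft k k (g⁻¹ * ·)
  map_one' := by ext; simp [LinearMap.funLeft_apply]
  map_mul' g h := by ext; simp [LinearMap.funLeft_apply, mul_assoc]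

@[simp] theorem translationRep_apply (g : G) (F : G → k) (x : G) :
    translationRep k G g F x = F (g⁻¹ * x) := rfl

/-- `σ(G) ≤ σ(N) σ(G/N)`: an `N`-invariant `f` on `V` yields a `G`-equivariant polynomial map from
`V` to the functions on `G/N`, whose value at `v` is `c ↦ f (c⁻¹ v)`. -/
theorem ZeroSeparates.of_quotient [Finite G] (N : Subgroup G) [N.Normal] {d e : ℕ}
    (h : ZeroSeparates k N d) (h' : ZeroSeparates k (G ⧸ N) e) :
    ZeroSeparates k G (d * e) := fun n ρ v hv => by
  classical
  have := Fintype.ofFinite (G ⧸ N)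
  let τ : Representation k N (Fin n → k) := ρ.comp N.subtype
  obtain ⟨f, hf, hfv⟩ := h n τ v hv
  let Φ : (Fin n → k) → (G ⧸ N) → k := fun w c => f (ρ c.out⁻¹ w)
  have hΦ (g : G) (w : Fin n → k) : Φ w g = f (ρ g⁻¹ w) := by
    obtain ⟨x, hx⟩ := QuotientGroup.mk_out_eq_mul N g
    have := apply_eq_of_mem_invariantsLE hf.1 x⁻¹ (ρ g⁻¹ w)
    simp only [Φ, hx, mul_inv_rev]
    rw [← this]
    simp [τ]
  have hequiv (g : G) (w : Fin n → k) :
      Φ (ρ g w) = translationRep k (G ⧸ N) (g : G ⧸ N) (Φ w) := by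
    ext c
    induction c using QuotientGroup.induction_on with
    | H x =>
      have h1 : ((g : G ⧸ N))⁻¹ * (x : G ⧸ N) = ((g⁻¹ * x : G) : G ⧸ N) := rfl
      rw [translationRep_apply, h1, hΦ, hΦ, ← Module.End.mul_apply, ← map_mul]
      simp
  have hΦv : Φ v ≠ 0 := fun h0 => hfv <| by
    have := congrFun h0 ((1 : G) : G ⧸ N)
    rw [hΦ] at this
    simpa using this
  have hΦ0 : Φ 0 = 0 := by
    ext c
    simpa [Φ] using hf.2
  obtain ⟨F, hF, hFv⟩ := h'.exists_mem (translationRep k (G ⧸ N)) hΦv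
  refine ⟨fun w => F (Φ w), ⟨mem_invariantsLE_of_apply_eq ?_ fun g w => ?_, ?_⟩, hFv⟩
  · refine hF.1.1.comp Φ fun φ => ?_
    have hφ (w : Fin n → k) := dual_apply_eq_sum φ (Φ w)
    simp only [hφ]
    refine IsPolyFunLE.sum _ fun c _ => ?_
    rw [← zero_add d]
    exact (isPolyFunLE_const _).mul (hf.1.1.comp_linear (ρ c.out⁻¹))
  · rw [hequiv, apply_eq_of_mem_invariantsLE hF.1]
  · dsimp only
    rw [hΦ0]
    exact hF.2

end Separation

/-! ### Abelian groups in the non-modular case -/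

section Eigenforms

variable {k A V : Type*} [Field k] [IsAlgClosed k] [Group A] [AddCommGroup V] [Module k V]
  [FiniteDimensional k V]

/-- If an abelian group of exponent dividing `n ≠ 0` acts linearly, then the linear forms that are
eigenvectors for the whole group separate every nonzero vector from zero. -/
theorem exists_eigenform (hA : ∀ a b : A, a * b = b * a) {n : ℕ} (hn : (n : k) ≠ 0)
    (hAn : ∀ a : A, a ^ n = 1) (ρ : Representation k A V) {v : V} (hv : v ≠ 0) :
    ∃ (φ : V →ₗ[k] k) (χ : A → k), (∀ a w, φ (ρ a w) = χ a * φ w) ∧ φ v ≠ 0 := by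
  let f (a : A) : Module.End k (Module.Dual k V) := (ρ a).dualMap
  have hcomm (a b : A) : Commute (f a) (f b) := by
    have h : ρ a * ρ b = ρ b * ρ a := by rw [← map_mul, hA, map_mul]
    ext φ w
    exact congrArg φ (LinearMap.congr_fun h w).symm
  have hpow (a : A) (m : ℕ) : f a ^ m = f (a ^ m) := by
    induction m with
    | zero => ext; simp [f]
    | succ m ih =>
      rw [pow_succ, ih]
      ext φ w
      simp [f, pow_succ', map_mul]
  have hss (a : A) : (f a).IsSemisimple := by
    refine Module.End.isSemisimple_of_squarefree_aeval_eq_zero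
      (Polynomial.separable_X_pow_sub_C (1 : k) hn one_ne_zero).squarefree ?_
    rw [map_sub, map_pow, Polynomial.aeval_X, hpow, hAn]
    ext
    simp [f]
  have htop := Module.End.iSup_iInf_maxGenEigenspace_eq_top_of_forall_mapsTo f
    (fun a b _ => Module.End.mapsTo_maxGenEigenspace_of_comm (hcomm b a) _)
    fun a => Module.End.iSup_maxGenEigenspace_eq_top _
  simp only [(hss _).isFinitelySemisimple.maxGenEigenspace_eq_eigenspace] at htop
  by_contra! hcon
  have hle : (⊤ : Submodule k (Module.Dual k V)) ≤
      LinearMap.ker (Module.Dual.eval k V v) := by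
    rw [← htop]
    refine iSup_le fun χ φ hφ => ?_
    rw [LinearMap.mem_ker, Module.Dual.eval_apply]
    refine hcon φ χ fun a w => ?_
    have := (Submodule.mem_iInf _).1 hφ a
    rw [Module.End.mem_eigenspace_iff] at this
    simpa [f] using LinearMap.congr_fun this w
  exact hv ((Module.forall_dual_apply_eq_zero_iff k v).1 fun φ => by
    simpa using hle (Submodule.mem_top (x := φ)))

/-- For an abelian group in the non-modular case a power of an eigenform is an invariant. -/
theorem zeroSeparates_exponent (hA : ∀ a b : A, a * b = b * a)
    (hn : (Monoid.exponent A : k) ≠ 0) : ZeroSeparates k A (Monoid.exponent A) :=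
  fun n ρ v hv => by
  obtain ⟨φ, χ, hφ, hφv⟩ := exists_eigenform hA hn Monoid.pow_exponent_eq_one ρ hv
  have hχ (a : A) : χ a ^ Monoid.exponent A = 1 := by
    have hmul (m : ℕ) : φ (ρ (a ^ m) v) = χ a ^ m * φ v := by
      induction m with
      | zero => simp
      | succ m ih => rw [pow_succ', map_mul, Module.End.mul_apply, hφ, ih]; ring
    have := hmul (Monoid.exponent A)
    rw [Monoid.pow_exponent_eq_one, map_one, Module.End.one_apply] at this
    exact mul_right_cancel₀ hφv (by rw [← this, one_mul])
  have h0 : Monoid.exponent A ≠ 0 := fun h0 => hn (by simp [h0])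
  refine ⟨fun w => φ w ^ Monoid.exponent A, ⟨mem_invariantsLE_of_apply_eq ?_ fun a w => ?_, ?_⟩,
    pow_ne_zero _ hφv⟩
  · simpa using (isPolyFunLE_linear φ).pow (Monoid.exponent A)
  · simp only [hφ, mul_pow, hχ, one_mul]
  · simp [h0]

end Eigenforms

/-! ### Non-abelian groups of order a product of two primes -/

section Metacyclic

/-- A short zero-sum sequence with prescribed support: if the members of `S` have distinct nonzero
weights modulo the prime `q`, then there is a weighted zero sum of length at most `q` whose support
is exactly `S`. -/
theorem exists_zero_sum_of_injOn {ι : Type*} [DecidableEq ι] {q : ℕ} [Fact q.Prime]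
    (S : Finset ι) (hS : S.Nonempty) (w : ι → ZMod q) (hw : Set.InjOn w S)
    (hw0 : ∀ i ∈ S, w i ≠ 0) :
    ∃ m : ι → ℕ, (∀ i ∈ S, m i ≠ 0) ∧ ∑ i ∈ S, m i ≤ q ∧ ∑ i ∈ S, (m i : ZMod q) * w i = 0 := by
  have hq : 0 < q := (Fact.out : q.Prime).pos
  set T := ∑ i ∈ S, w i with hT
  -- adding `c i` to the multiplicity of `i` in the all-one sequence kills its sum `T`
  let c (i : ι) : ZMod q := -T / w i
  have hcard : S.card ≤ q := by
    have := Finset.card_le_univ (S.image w)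
    rwa [Finset.card_image_of_injOn hw, ZMod.card] at this
  obtain ⟨i₀, hi₀, hc⟩ : ∃ i ∈ S, (c i).val + S.card ≤ q := by
    by_cases hT0 : T = 0
    · obtain ⟨i, hi⟩ := hS
      exact ⟨i, hi, by simpa [c, hT0] using hcard⟩
    by_contra! hcon
    -- the `c i` would be `#S` different residues among `q - #S + 1, …, q - 1`
    have hmaps : ∀ i ∈ S, (c i).val ∈ Finset.Ico (q - S.card + 1) q := fun i hi => by
      have := hcon i hi
      rw [Finset.mem_Ico]
      exact ⟨by omega, ZMod.val_lt _⟩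
    have hinj : Set.InjOn (fun i => (c i).val) S := fun i hi j hj hij => by
      have h1 : -T / w i = -T / w j := ZMod.val_injective q hij
      refine hw hi hj ?_
      have hi0 := hw0 i hi
      have hj0 := hw0 j hj
      rw [div_eq_div_iff hi0 hj0] at h1
      exact (mul_left_cancel₀ (neg_ne_zero.2 hT0) h1).symm
    have := Finset.card_le_card_of_injOn _ hmaps hinj
    rw [Nat.card_Ico] at this
    have := hS.card_pos
    omega
  refine ⟨fun i => 1 + if i = i₀ then (c i₀).val else 0,
    fun i _ => (Nat.add_pos_left one_pos _).ne', ?_, ?_⟩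
  · rw [Finset.sum_add_distrib, Finset.sum_ite_eq' S i₀]
    simp only [Finset.sum_const, smul_eq_mul, mul_one, hi₀, if_true]
    omega
  · simp only [Nat.cast_add, Nat.cast_one, add_mul, one_mul, Finset.sum_add_distrib,
      Nat.cast_ite, Nat.cast_zero, ite_mul, zero_mul]
    rw [Finset.sum_ite_eq' S i₀]
    simp only [hi₀, if_true, ZMod.natCast_val, ZMod.cast_id', id_eq, c, ← hT]
    rw [div_mul_cancel₀ _ (hw0 i₀ hi₀)]
    ring

variable {k G : Type*} [Field k] [IsAlgClosed k] [Group G]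

/-- A nonempty subset of `ℤ/r`, `r` prime, stable under a nonzero translation is everything. -/
theorem eq_univ_of_forall_add_mem {r : ℕ} [Fact r.Prime] {S : Finset (ZMod r)} (hS : S.Nonempty)
    {c : ZMod r} (hc : c ≠ 0) (h : ∀ j ∈ S, j + c ∈ S) : S = Finset.univ := by
  obtain ⟨j, hj⟩ := hS
  have hmem (n : ℕ) : j + n * c ∈ S := by
    induction n with
    | zero => simpa using hj
    | succ n ih =>
      have := h _ ih
      rwa [add_assoc, ← add_one_mul, ← Nat.cast_succ] at this
  refine Finset.eq_univ_iff_forall.2 fun i => ?_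
  have := hmem ((i - j) / c).val
  rwa [ZMod.natCast_zmod_val, div_mul_cancel₀ _ hc, add_sub_cancel] at this

theorem pow_mul_eq_of_conj_eq_pow {G : Type*} [Group G] {a y : G} {s : ℕ}
    (h : y * a * y⁻¹ = a ^ s) (j : ℕ) : y ^ j * a = a ^ s ^ j * y ^ j := by
  induction j with
  | zero => simp
  | succ j ih =>
    have hy (m : ℕ) : y * a ^ m = a ^ (s * m) * y := by
      rw [pow_mul, ← h, conj_pow]
      group
    rw [pow_succ', mul_assoc, ih, ← mul_assoc, hy, mul_assoc, pow_succ' s]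

/-- The case of a non-abelian extension of a group of prime order `r` by a group of prime order
`q`. The translates `x j` of an eigenform of the normal subgroup under powers of `y` are again
eigenforms. If all of them are nonzero at the given vector, their product is a suitable invariant.
Otherwise it is the orbit sum of an invariant monomial that involves exactly the `x j` that do
not vanish at the vector. -/
theorem zeroSeparates_of_metacyclic {q r s : ℕ} (hq : q.Prime) (hr : r.Prime) (hqk : (q : k) ≠ 0)
    {a y : G} (hay : Subgroup.closure {a, y} = ⊤) (haq : a ^ q = 1) (hyr : y ^ r = 1)
    (hyay : y * a * y⁻¹ = a ^ s) (hs1 : (s : ZMod q) ≠ 1) (hsr : (s : ZMod q) ^ r = 1) :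
    ZeroSeparates k G q := fun n ρ v hv => by
  classical
  have := Fact.mk hq
  have := Fact.mk hr
  have hA : ∀ b c : Subgroup.zpowers a, b * c = c * b := fun b c =>
    (inferInstance : IsMulCommutative (Subgroup.zpowers a)).is_comm.comm b c
  have hAq : ∀ b : Subgroup.zpowers a, b ^ q = 1 := by
    rintro ⟨b, hb⟩
    obtain ⟨m, rfl⟩ := Subgroup.mem_zpowers_iff.1 hb
    ext
    simp only [SubmonoidClass.mk_pow, OneMemClass.coe_one]
    rw [← zpow_natCast, zpow_comm, zpow_natCast, haq, one_zpow]
  let τ : Representation k (Subgroup.zpowers a) (Fin n → k) := ρ.comp (Subgroup.subtype _)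
  obtain ⟨φ, χ, hφ, hφv⟩ := exists_eigenform hA hqk hAq τ hv
  set l : k := χ ⟨a, Subgroup.mem_zpowers a⟩ with hl
  have hφa (w : Fin n → k) : φ (ρ a w) = l * φ w := hφ ⟨a, Subgroup.mem_zpowers a⟩ w
  have hφpow (m : ℕ) (w : Fin n → k) : φ (ρ (a ^ m) w) = l ^ m * φ w := by
    induction m generalizing w with
    | zero => simp
    | succ m ih => rw [pow_succ, map_mul, Module.End.mul_apply, ih, hφa]; ring
  have hlq : l ^ q = 1 := by
    have := hφpow q v
    rw [haq, map_one, Module.End.one_apply] at this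
    exact mul_right_cancel₀ hφv (by rw [← this, one_mul])
  have hl_of_zmod {m : ℕ} (hm : (m : ZMod q) = 0) : l ^ m = 1 := by
    obtain ⟨t, rfl⟩ := (ZMod.natCast_eq_zero_iff _ _).1 hm
    rw [pow_mul, hlq, one_pow]
  have hconj := pow_mul_eq_of_conj_eq_pow hyay
  have hymod (m : ℕ) : y ^ m = y ^ (m % r) := pow_eq_pow_mod m hyr
  let x (j : ZMod r) (w : Fin n → k) : k := φ (ρ (y ^ j.val) w)
  have hxy (j : ZMod r) (w : Fin n → k) : x j (ρ y w) = x (j + 1) w := by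
    simp only [x]
    rw [← Module.End.mul_apply, ← map_mul, ← pow_succ, hymod, ZMod.val_add, ZMod.val_one]
  have hxa (j : ZMod r) (w : Fin n → k) : x j (ρ a w) = l ^ s ^ j.val * x j w := by
    simp only [x]
    rw [← Module.End.mul_apply, ← map_mul, hconj, map_mul, Module.End.mul_apply, hφpow]
  have hxdeg (j : ZMod r) : IsPolyFunLE 1 (x j) :=
    (isPolyFunLE_linear φ).comp_linear (ρ (y ^ j.val))
  have hx0 (j : ZMod r) : x j 0 = 0 := by simp [x]
  have hinv (f : (Fin n → k) → k) (h1 : ∀ w, f (ρ a w) = f w) (h2 : ∀ w, f (ρ y w) = f w)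
      (g : G) (w : Fin n → k) : f (ρ g w) = f w := by
    have hg : g ∈ Subgroup.closure {a, y} := hay ▸ Subgroup.mem_top g
    induction hg using Subgroup.closure_induction generalizing w with
    | mem g hg =>
      rcases hg with rfl | rfl
      exacts [h1 w, h2 w]
    | one => simp
    | mul g h _ _ hg hh => rw [map_mul, Module.End.mul_apply, hg, hh]
    | inv g _ hg => rw [← hg, ← Module.End.mul_apply, ← map_mul, mul_inv_cancel, map_one]; rfl
  -- the weights of the `x j` and their sum
  have hord : orderOf (s : ZMod q) = r := orderOf_eq_prime hsr hs1
  have hs0 : (s : ZMod q) ≠ 0 := fun h0 => by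
    rw [h0, zero_pow hr.ne_zero] at hsr
    exact zero_ne_one hsr
  let wt (j : ZMod r) : ZMod q := (s : ZMod q) ^ j.val
  have hwt : Function.Injective wt := fun i j hij => by
    refine ZMod.val_injective r (pow_injOn_Iio_orderOf ?_ ?_ hij) <;>
    · rw [hord]; exact ZMod.val_lt _
  have hrq : r ≤ q := by
    simpa using Fintype.card_le_of_injective wt hwt
  let S : Finset (ZMod r) := Finset.univ.filter fun j => x j v ≠ 0
  have hSmem (j : ZMod r) : j ∈ S ↔ x j v ≠ 0 := by simp [S]
  have hSne : S.Nonempty := ⟨0, by simpa [hSmem, x] using hφv⟩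
  by_cases hSu : S = Finset.univ
  · refine ⟨fun w => ∏ j, x j w, ⟨mem_invariantsLE_of_apply_eq ?_
      (hinv (fun w => ∏ j, x j w) (fun w => ?_) fun w => ?_), ?_⟩, ?_⟩
    · have := IsPolyFunLE.prod (d := fun _ => 1) Finset.univ fun (j : ZMod r) _ => hxdeg j
      exact this.mono (by simpa using hrq)
    · simp only [hxa, Finset.prod_mul_distrib, Finset.prod_pow_eq_pow_sum]
      rw [hl_of_zmod, one_mul]
      have h1 : ∑ j : ZMod r, (s : ZMod q) ^ j.val = ∑ i ∈ Finset.range r, (s : ZMod q) ^ i := by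
        refine Finset.sum_bij' (fun j _ => j.val) (fun i _ => (i : ZMod r)) ?_ ?_ ?_ ?_ ?_ <;>
          simp +contextual [ZMod.val_lt, ZMod.val_natCast, Nat.mod_eq_of_lt]
      push_cast
      rw [h1, geom_sum_eq hs1, hsr, sub_self, zero_div]
    · simp only [hxy]
      exact Equiv.prod_comp (Equiv.addRight (1 : ZMod r)) fun j => x j w
    · exact Finset.prod_eq_zero (Finset.mem_univ 0) (hx0 0)
    · exact Finset.prod_ne_zero_iff.2 fun j _ => (hSmem j).1 (hSu ▸ Finset.mem_univ j)
  · obtain ⟨m, hm0, hmq, hmw⟩ := exists_zero_sum_of_injOn S hSne wt hwt.injOn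
      fun j _ => pow_ne_zero _ hs0
    refine ⟨fun w => ∑ c, ∏ j ∈ S, x (j + c) w ^ m j,
      ⟨mem_invariantsLE_of_apply_eq ?_ (hinv (fun w => ∑ c, ∏ j ∈ S, x (j + c) w ^ m j)
        (fun w => ?_) fun w => ?_), ?_⟩, ?_⟩
    · refine IsPolyFunLE.sum _ fun c _ => ?_
      have := IsPolyFunLE.prod (d := fun j => m j * 1) S fun (j : ZMod r) _ =>
        (hxdeg (j + c)).pow (m j)
      exact this.mono (by simpa using hmq)
    · refine Finset.sum_congr rfl fun c _ => ?_
      simp only [hxa, mul_pow, Finset.prod_mul_distrib, ← pow_mul, Finset.prod_pow_eq_pow_sum]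
      rw [hl_of_zmod, one_mul]
      have hadd (j : ZMod r) : (s : ZMod q) ^ (j + c).val = (s : ZMod q) ^ c.val * wt j := by
        rw [ZMod.val_add, ← pow_eq_pow_mod _ hsr, pow_add, mul_comm]
      push_cast
      simp only [hadd, mul_assoc, ← Finset.mul_sum]
      simp only [mul_comm (wt _), hmw, mul_zero]
    · simp only [hxy, add_assoc]
      exact Equiv.sum_comp (Equiv.addRight (1 : ZMod r)) fun c => ∏ j ∈ S, x (j + c) w ^ m j
    · refine Finset.sum_eq_zero fun c _ => ?_
      obtain ⟨j, hj⟩ := hSne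
      exact Finset.prod_eq_zero hj (by rw [hx0, zero_pow (hm0 j hj)])
    · dsimp only
      -- only the untranslated monomial survives
      rw [Finset.sum_eq_single 0]
      · simp only [add_zero]
        exact Finset.prod_ne_zero_iff.2 fun j hj => pow_ne_zero _ ((hSmem j).1 hj)
      · intro c _ hc
        by_contra hprod
        refine hSu (eq_univ_of_forall_add_mem hSne hc fun j hj => (hSmem _).2 fun h0 => ?_)
        exact hprod (Finset.prod_eq_zero hj (by rw [h0, zero_pow (hm0 j hj)]))
      · simp

end Metacyclic

/-! ### Groups that improve Noether's bound -/

section SavesPrime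

/-- In a cyclic group every endomorphism is a power map, so conjugation by an element normalizing
a cyclic subgroup normalizes each of its subgroups. -/
theorem conj_mem_zpowers_of_isCyclic {G : Type*} [Group G] {H : Subgroup G} [H.Normal] [IsCyclic H]
    {h : G} (hh : h ∈ H) (x : G) : x * h * x⁻¹ ∈ Subgroup.zpowers h := by
  obtain ⟨m, hm⟩ := MonoidHom.map_cyclic (MulAut.conjNormal (H := H) x).toMonoidHom
  have := congrArg Subtype.val (hm ⟨h, hh⟩)
  refine Subgroup.mem_zpowers_iff.2 ⟨m, ?_⟩
  simpa using this.symm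

variable {k G : Type*} [Field k] [IsAlgClosed k] [Group G] [Finite G]

variable (k G) in
/-- Noether's bound `σ(G) ≤ |G|` can be improved by a prime factor `r` of `|G|`, that is,
`r σ(G) ≤ |G|`. -/
def SavesPrime : Prop :=
  ∃ r d : ℕ, r.Prime ∧ r ∣ Nat.card G ∧ ZeroSeparates k G d ∧ d * r ≤ Nat.card G

theorem SavesPrime.of_subgroup (H : Subgroup G) (h : SavesPrime k H) : SavesPrime k G := by
  obtain ⟨r, d, hr, hrH, hd, hle⟩ := h
  refine ⟨r, H.index * d, hr, hrH.trans H.card_subgroup_dvd_card, hd.of_subgroup H, ?_⟩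
  rw [← H.index_mul_card, mul_assoc]
  exact Nat.mul_le_mul_left _ hle

theorem SavesPrime.of_quotient (N : Subgroup G) [N.Normal] (h : SavesPrime k (G ⧸ N)) :
    SavesPrime k G := by
  obtain ⟨r, d, hr, hrH, hd, hle⟩ := h
  refine ⟨r, Nat.card N * d, hr, hrH.trans N.card_quotient_dvd_card,
    zeroSeparates_card.of_quotient N hd, ?_⟩
  rw [N.card_eq_card_quotient_mul_card_subgroup, mul_comm (Nat.card (G ⧸ N)), mul_assoc]
  exact Nat.mul_le_mul_left _ hle

theorem savesPrime_of_commutative (hA : ∀ a b : G, a * b = b * a) (hn : (Nat.card G : k) ≠ 0)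
    (hG : ¬ IsCyclic G) : SavesPrime k G := by
  obtain ⟨t, ht⟩ := Group.exponent_dvd_nat_card (G := G)
  have ht1 : t ≠ 1 := by
    rintro rfl
    let _ : CommGroup G := { (inferInstance : Group G) with mul_comm := hA }
    exact hG (IsCyclic.of_exponent_eq_card (by rw [ht, mul_one]))
  have hpos : 0 < Nat.card G := Nat.card_pos
  have hexp : (Monoid.exponent G : k) ≠ 0 := fun h0 => hn (by rw [ht, Nat.cast_mul, h0, zero_mul])
  refine ⟨t.minFac, _, Nat.minFac_prime ht1, (Nat.minFac_dvd t).trans ⟨_, ht.trans (mul_comm _ _)⟩,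
    zeroSeparates_exponent hA hexp, ?_⟩
  rw [ht] at hpos ⊢
  exact Nat.mul_le_mul_left _ (Nat.minFac_le (Nat.pos_of_mul_pos_left hpos))

theorem savesPrime_of_closure_eq_top {q r s : ℕ} (hq : q.Prime) (hr : r.Prime)
    (hqk : (q : k) ≠ 0) {a y : G} (hay : Subgroup.closure {a, y} = ⊤) (ha : orderOf a = q)
    (hyay : y * a * y⁻¹ = a ^ s) (hy : y * a ≠ a * y) (hyr : y ^ r * a = a * y ^ r) :
    SavesPrime k G := by
  have := Fact.mk hq
  have hconj := pow_mul_eq_of_conj_eq_pow hyay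
  have hs1 : (s : ZMod q) ≠ 1 := fun h => hy <| by
    have : a ^ s = a ^ 1 := by
      rw [pow_eq_pow_iff_modEq, ha, ← ZMod.natCast_eq_natCast_iff, h, Nat.cast_one]
    rw [this, pow_one, mul_inv_eq_iff_eq_mul] at hyay
    exact hyay
  have hsr : (s : ZMod q) ^ r = 1 := by
    have h1 : a ^ s ^ r = a ^ 1 := by
      rw [pow_one]
      exact mul_right_cancel ((hconj r).symm.trans hyr)
    rw [pow_eq_pow_iff_modEq, ha, ← ZMod.natCast_eq_natCast_iff] at h1
    exact_mod_cast h1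
  have hrq : r ≠ q := by
    rintro rfl
    rw [ZMod.pow_card] at hsr
    exact hs1 hsr
  -- divide out the central subgroup generated by `y ^ r`
  let Z : Subgroup G := Subgroup.zpowers (y ^ r)
  have hcenter : Z ≤ Subgroup.center G := by
    rw [Subgroup.zpowers_le, ← Subgroup.centralizer_univ, ← Subgroup.coe_top, ← hay,
      Subgroup.centralizer_closure]
    simp only [Subgroup.mem_centralizer_iff, Set.mem_insert_iff, Set.mem_singleton_iff]
    rintro z (rfl | rfl)
    exacts [hyr.symm, (pow_succ' _ _).symm.trans (pow_succ _ _)]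
  have hcen {z : G} (hz : z ∈ Z) (g : G) : g * z = z * g :=
    Subgroup.mem_center_iff.1 (hcenter hz) g
  have : Z.Normal := ⟨fun z hz g => by rwa [hcen hz g, mul_inv_cancel_right]⟩
  refine SavesPrime.of_quotient Z ?_
  let π : G →* G ⧸ Z := QuotientGroup.mk' Z
  have haπ : orderOf (π a) = q := by
    refine orderOf_eq_prime (by rw [← map_pow, ← ha, pow_orderOf_eq_one, map_one]) fun h1 => ?_
    exact hy (hcen ((QuotientGroup.eq_one_iff a).1 h1) y)
  have hyπr : π y ^ r = 1 := by
    rw [← map_pow]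
    exact (QuotientGroup.eq_one_iff _).2 (Subgroup.mem_zpowers _)
  have hyπ : orderOf (π y) = r := by
    have := Fact.mk hr
    refine orderOf_eq_prime hyπr fun h1 => ?_
    exact hy (hcen ((QuotientGroup.eq_one_iff y).1 h1) a).symm
  have hclosure : Subgroup.closure {π a, π y} = ⊤ := by
    rw [← Set.image_pair, ← MonoidHom.map_closure, hay, ← MonoidHom.range_eq_map,
      MonoidHom.range_eq_top]
    exact QuotientGroup.mk'_surjective Z
  refine ⟨r, q, hr, hyπ ▸ orderOf_dvd_natCard _, zeroSeparates_of_metacyclic hq hr hqk hclosure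
    (haπ ▸ pow_orderOf_eq_one _) hyπr ?_ hs1 hsr, Nat.le_of_dvd Nat.card_pos ?_⟩
  · rw [← map_inv, ← map_mul, ← map_mul, hyay, map_pow]
  · exact ((Nat.coprime_primes hq hr).2 hrq.symm).mul_dvd_of_dvd_of_dvd
      (haπ ▸ orderOf_dvd_natCard _) (hyπ ▸ orderOf_dvd_natCard _)

/-- If an element `x` normalizes but does not centralize a subgroup of prime order, then the group
generated by that subgroup and a suitable power of `x` has a non-abelian quotient of order a
product of two primes. -/
theorem savesPrime_of_conj_mem_zpowers {q : ℕ} (hq : q.Prime) (hqk : (q : k) ≠ 0) {a x : G}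
    (ha : orderOf a = q) (hxa : x * a * x⁻¹ ∈ Subgroup.zpowers a) (hx : x * a ≠ a * x) :
    SavesPrime k G := by
  classical
  have hex : ∃ n, 0 < n ∧ x ^ n * a = a * x ^ n := ⟨orderOf x, orderOf_pos x, by simp⟩
  set n := Nat.find hex with hn
  obtain ⟨hn0, hnx⟩ := Nat.find_spec hex
  rw [← hn] at hn0 hnx
  have hn1 : n ≠ 1 := fun h1 => hx (by rwa [h1, pow_one] at hnx)
  obtain ⟨r, hr, m, hm⟩ := Nat.exists_prime_and_dvd hn1
  have hm0 : 0 < m := Nat.pos_of_ne_zero fun h0 => by simp [h0] at hm; omega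
  set y := x ^ m with hy
  have hya : y * a ≠ a * y := fun h => by
    have hle : n ≤ m := Nat.find_min' hex ⟨hm0, h⟩
    have := hr.two_le
    nlinarith
  have hyr : y ^ r * a = a * y ^ r := by rwa [hy, ← pow_mul, mul_comm, ← hm]
  have hconj (j : ℕ) : x ^ j * a * (x ^ j)⁻¹ ∈ Subgroup.zpowers a := by
    induction j with
    | zero => simp
    | succ j ih =>
      obtain ⟨i, hi⟩ := Subgroup.mem_zpowers_iff.1 ih
      have : x ^ (j + 1) * a * (x ^ (j + 1))⁻¹ = (x * a * x⁻¹) ^ i := by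
        rw [conj_zpow, hi, pow_succ']
        group
      rw [this]
      exact zpow_mem hxa i
  obtain ⟨s, hs⟩ := mem_powers_iff_mem_zpowers.2 (hconj m)
  let K : Subgroup G := Subgroup.closure {a, y}
  have haK : a ∈ K := Subgroup.subset_closure (by simp)
  have hyK : y ∈ K := Subgroup.subset_closure (by simp)
  refine SavesPrime.of_subgroup K (savesPrime_of_closure_eq_top (a := ⟨a, haK⟩) (y := ⟨y, hyK⟩)
    (s := s) hq hr hqk ?_ ?_ ?_ ?_ ?_)
  · have := Subgroup.closure_closure_coe_preimage (k := ({a, y} : Set G))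
    convert this using 2
    ext ⟨z, hz⟩
    simp
  · simpa using ha
  · ext
    simpa using hs.symm
  · simpa [Subtype.ext_iff] using hya
  · simpa [Subtype.ext_iff] using hyr

/-- A finite non-cyclic group of order prime to the characteristic has `σ(G) ≤ |G| / r` for some
prime divisor `r` of `|G|`. One may assume that all proper subgroups and quotients are cyclic. If
the group is not abelian, then its centre is trivial and it is solvable, so it has a normal
subgroup of prime order, which is not central. -/
theorem savesPrime_of_not_isCyclic (hn : (Nat.card G : k) ≠ 0) (hG : ¬ IsCyclic G) :
    SavesPrime k G := by
  induction hcard : Nat.card G using Nat.strong_induction_on generalizing G with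
  | h n ih =>
  subst hcard
  by_cases hA : ∀ a b : G, a * b = b * a
  · exact savesPrime_of_commutative hA hn hG
  by_contra hcon
  have hsub (H : Subgroup G) (hH : H ≠ ⊤) : IsCyclic H := by
    by_contra hcyc
    refine hcon (SavesPrime.of_subgroup H (ih (Nat.card H) ?_ ?_ hcyc rfl))
    · exact lt_of_le_of_ne H.card_le_card_group fun h => hH (H.eq_top_of_card_eq h)
    · intro h0
      rw [← H.index_mul_card, Nat.cast_mul, h0, mul_zero] at hn
      exact hn rfl
  have hquot (N : Subgroup G) [N.Normal] (hN : N ≠ ⊥) : IsCyclic (G ⧸ N) := by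
    by_contra hcyc
    refine hcon (SavesPrime.of_quotient N (ih (Nat.card (G ⧸ N)) ?_ ?_ hcyc rfl))
    · have h1 : 1 < Nat.card N := (Subgroup.one_lt_card_iff_ne_bot N).2 hN
      have h2 : 0 < Nat.card (G ⧸ N) := Nat.card_pos
      rw [N.card_eq_card_quotient_mul_card_subgroup]
      nlinarith
    · intro h0
      rw [N.card_eq_card_quotient_mul_card_subgroup, Nat.cast_mul, h0, zero_mul] at hn
      exact hn rfl
  have hcenter : Subgroup.center G = ⊥ := by
    by_contra hZ
    have := hquot _ hZ
    exact hA (MonoidHom.isMulCommutative_of_isCyclic_of_ker_le_center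
      (QuotientGroup.mk' (Subgroup.center G)) (by simp)).is_comm.comm
  have : Nontrivial G := by
    by_contra h
    rw [not_nontrivial_iff_subsingleton] at h
    exact hA fun a b => Subsingleton.elim _ _
  have hZG : IsZGroup G := ⟨fun p hp P => by
    have := Fact.mk hp
    refine hsub P fun hP => ?_
    have hpG : IsPGroup p G := by
      have := P.isPGroup'
      rw [hP] at this
      exact this.of_equiv Subgroup.topEquiv
    have := hpG.center_nontrivial
    rw [hcenter] at this
    exact not_nontrivial _ this⟩
  have : IsCyclic (commutator G) := hsub _ (IsZGroup.commutator_lt G).ne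
  have hne : commutator G ≠ ⊥ := fun h => hA fun a b => by
    have : a ∈ Subgroup.center G :=
      (commutator_eq_bot_iff_center_eq_top G).1 h ▸ Subgroup.mem_top a
    exact (Subgroup.mem_center_iff.1 this b).symm
  have h1 : Nat.card (commutator G) ≠ 1 := fun h => hne (Subgroup.card_eq_one.1 h)
  obtain ⟨q, hq, hqd⟩ := Nat.exists_prime_and_dvd h1
  have := Fact.mk hq
  obtain ⟨⟨a, haC⟩, ha⟩ := exists_prime_orderOf_dvd_card' q hqd
  have ha' : orderOf a = q := by simpa using ha
  have haZ : a ∉ Subgroup.center G := by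
    rw [hcenter, Subgroup.mem_bot]
    rintro rfl
    rw [orderOf_one] at ha'
    exact hq.one_lt.ne ha'
  simp only [Subgroup.mem_center_iff, not_forall] at haZ
  obtain ⟨x, hx⟩ := haZ
  refine hcon (savesPrime_of_conj_mem_zpowers hq (fun h0 => hn ?_) ha'
    (conj_mem_zpowers_of_isCyclic haC x) hx)
  obtain ⟨t, ht⟩ := hqd.trans (commutator G).card_subgroup_dvd_card
  rw [ht, Nat.cast_mul, h0, zero_mul]

/-- A `p`-element acting non-trivially on a normal cyclic `p'`-subgroup acts non-trivially on a
subgroup of prime order. An element `h` of minimal order not fixed by `x` has prime order: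
otherwise the commutator of `x` and `h` is a fixed element of prime order `q ≠ p`, so that `h` is
moved by all powers of `x` of exponent prime to `q`. -/
theorem exists_prime_orderOf_not_commute {H : Subgroup G} [H.Normal] [IsCyclic H] {x : G}
    (hcop : (Nat.card H).Coprime (orderOf x)) (hx : ∃ h ∈ H, x * h ≠ h * x) :
    ∃ h ∈ H, (orderOf h).Prime ∧ x * h ≠ h * x := by
  classical
  have hex : ∃ n, ∃ h ∈ H, orderOf h = n ∧ x * h ≠ h * x := by
    obtain ⟨h, hh, hne⟩ := hx
    exact ⟨_, h, hh, rfl, hne⟩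
  obtain ⟨h, hh, hord, hne⟩ := Nat.find_spec hex
  have hmin {h' : G} (hh' : h' ∈ H) (hlt : orderOf h' < orderOf h) : x * h' = h' * x := by
    by_contra hne'
    exact Nat.find_min hex (hord ▸ hlt) ⟨h', hh', rfl, hne'⟩
  refine ⟨h, hh, ?_, hne⟩
  have hh1 : orderOf h ≠ 1 := fun h1 => hne (by rw [orderOf_eq_one_iff.1 h1]; simp)
  obtain ⟨q, hq, hqd⟩ := Nat.exists_prime_and_dvd hh1
  by_contra hnp
  have hlt : q < orderOf h :=
    lt_of_le_of_ne (Nat.le_of_dvd (orderOf_pos h) hqd) fun h => hnp (h ▸ hq)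
  have hpow : x * h ^ q = h ^ q * x := by
    refine hmin (pow_mem hh q) ?_
    rw [orderOf_pow_of_dvd hq.ne_zero hqd]
    exact Nat.div_lt_self (orderOf_pos h) hq.one_lt
  set c := x * h * x⁻¹ * h⁻¹ with hc
  have hcomm (u v : G) (hu : u ∈ H) (hv : v ∈ H) : Commute u v := by
    have : (⟨u, hu⟩ : H) * ⟨v, hv⟩ = ⟨v, hv⟩ * ⟨u, hu⟩ :=
      (inferInstance : IsMulCommutative H).is_comm.comm _ _
    exact congrArg Subtype.val this
  have hxh : x * h * x⁻¹ ∈ H := Subgroup.Normal.conj_mem inferInstance h hh x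
  have hcH : c ∈ H := mul_mem hxh (inv_mem hh)
  have hcq : c ^ q = 1 := by
    rw [hc, (hcomm _ _ hxh (inv_mem hh)).mul_pow, conj_pow, hpow]
    simp
  have hxc : x * c = c * x := hmin hcH
    ((Nat.le_of_dvd hq.pos (orderOf_dvd_of_pow_eq_one hcq)).trans_lt hlt)
  have hiter (j : ℕ) : x ^ j * h = c ^ j * h * x ^ j := by
    induction j with
    | zero => simp
    | succ j ih =>
      have h1 : x * h = c * h * x := by rw [hc]; group
      have h2 : x * c ^ j = c ^ j * x := (show Commute x c from hxc).pow_right j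
      rw [pow_succ', mul_assoc, ih, ← mul_assoc, ← mul_assoc, h2, mul_assoc (c ^ j), h1, pow_succ]
      simp only [mul_assoc]
  have hcx : c ^ orderOf x = 1 := by
    have := hiter (orderOf x)
    rw [pow_orderOf_eq_one, one_mul, mul_one] at this
    exact (right_eq_mul.1 this)
  have hc1 : orderOf c = 1 := by
    have h1 : orderOf c ∣ Nat.card H := by
      simpa using orderOf_dvd_natCard (⟨c, hcH⟩ : H)
    exact Nat.eq_one_of_dvd_coprimes hcop h1 (orderOf_dvd_of_pow_eq_one hcx)
  have hc1 : x * h * x⁻¹ * h⁻¹ = 1 := orderOf_eq_one_iff.1 hc1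
  exact hne (by rwa [mul_inv_eq_one, mul_inv_eq_iff_eq_mul] at hc1)

end SavesPrime

/-! ### The lower bound from characters of normalizers -/

section LowerBound

variable {k G : Type*} [Field k] [Group G]

/-- Polynomial functions on `ι → k` are polynomials in the coordinates. -/
theorem IsPolyFunLE.exists_mvPolynomial {ι : Type*} [Fintype ι] {d : ℕ} {f : (ι → k) → k}
    (hf : IsPolyFunLE d f) :
    ∃ Q : MvPolynomial ι k, Q.totalDegree ≤ d ∧ ∀ w, f w = MvPolynomial.eval w Q := by
  classical
  obtain ⟨F, hF, hf⟩ := hf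
  let L (φ : Module.Dual k (ι → k)) : MvPolynomial ι k :=
    ∑ i, MvPolynomial.C (φ (Pi.single i 1)) * MvPolynomial.X i
  have hL (φ : Module.Dual k (ι → k)) (w : ι → k) : MvPolynomial.eval w (L φ) = φ w := by
    simp only [L, map_sum, map_mul, MvPolynomial.eval_C, MvPolynomial.eval_X]
    exact (dual_apply_eq_sum φ w).symm
  have hLdeg (φ : Module.Dual k (ι → k)) : (L φ).totalDegree ≤ 1 := by
    refine MvPolynomial.totalDegree_finsetSum_le fun i _ => ?_
    refine (MvPolynomial.totalDegree_mul _ _).trans ?_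
    simp
  refine ⟨∑ m ∈ F.support, MvPolynomial.C (F.coeff m) * ∏ φ ∈ m.support, L φ ^ m φ, ?_,
    fun w => ?_⟩
  · refine MvPolynomial.totalDegree_finsetSum_le fun m hm => ?_
    refine (MvPolynomial.totalDegree_mul _ _).trans ?_
    rw [MvPolynomial.totalDegree_C, zero_add]
    refine (MvPolynomial.totalDegree_finsetProd _ _).trans
      (le_trans (Finset.sum_le_sum fun φ _ => ?_) ((MvPolynomial.le_totalDegree hm).trans hF))
    refine (MvPolynomial.totalDegree_pow _ _).trans ?_
    simpa using Nat.mul_le_mul_left (m φ) (hLdeg φ)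
  · rw [hf, MvPolynomial.eval_eq]
    simp [hL]

/-- In characteristic `p` a `p`-group acting without fixed points on a finite set makes the sum of
any invariant function vanish: each level set has cardinality divisible by `p`. -/
theorem sum_eq_zero_of_forall_exists_smul_ne {p : ℕ} [Fact p.Prime] [CharP k p] {P α : Type*}
    [Group P] (hP : IsPGroup p P) [MulAction P α] (s : Finset α) (F : α → k)
    (hs : ∀ (g : P), ∀ a ∈ s, g • a ∈ s) (hF : ∀ (g : P), ∀ a ∈ s, F (g • a) = F a)
    (hfix : ∀ a ∈ s, ∃ g : P, g • a ≠ a) : ∑ a ∈ s, F a = 0 := by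
  classical
  have hcomp := Finset.sum_comp (s := s) (fun c : k => c) F
  rw [hcomp]
  refine Finset.sum_eq_zero fun c _ => ?_
  let X : SubMulAction P α :=
    { carrier := {a | a ∈ s ∧ F a = c}
      smul_mem' := fun g a ha => ⟨hs g a ha.1, (hF g a ha.1).trans ha.2⟩ }
  have hXcard : Nat.card X = (s.filter fun a => F a = c).card :=
    Nat.subtype_card _ fun a => by simp; rfl
  have : Finite X := Set.Finite.subset s.finite_toSet fun a ha => ha.1
  have hmod := hP.card_modEq_card_fixedPoints X
  have : IsEmpty (MulAction.fixedPoints P X) := ⟨fun ⟨⟨a, ha⟩, hfixed⟩ => by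
    obtain ⟨g, hg⟩ := hfix a ha.1
    exact hg (congrArg Subtype.val (hfixed g))⟩
  rw [@Nat.card_of_isEmpty (MulAction.fixedPoints P X), Nat.modEq_zero_iff_dvd, hXcard,
    ← CharP.cast_eq_zero_iff k p] at hmod
  rw [nsmul_eq_mul, hmod, zero_mul]

/-- The lower bound behind the equality `σ(G) = |G|`. Let the character `χ` of `N ≤ G` be trivial
on the `p`-subgroup `P ≤ N`, and extend `χ` by zero to a function `v` on `G`. The left translates
of `v` under `N` are multiples of `v`. Let an invariant polynomial `Q` without constant term be
nonzero at `v`, and let `e` be the degree of a homogeneous part of it that is nonzero at `v`.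
Invariance under `N` yields `χ ^ e = 1`. By `sum_eq_zero_of_forall_exists_smul_ne` this part
contains a monomial of degree `e` fixed by `P`, so its exponents are constant on the cosets `P x`,
and `|P|` divides `e`. -/
theorem ZeroSeparates.exists_card_dvd [Infinite k] [Finite G] {p : ℕ} [Fact p.Prime] [CharP k p]
    {N P : Subgroup G} (hPN : P ≤ N) (hP : IsPGroup p P) (χ : N →* kˣ)
    (hχ : ∀ (h : G) (hh : h ∈ P), χ ⟨h, hPN hh⟩ = 1) {d : ℕ} (hd : ZeroSeparates k G d) :
    ∃ e, 0 < e ∧ e ≤ d ∧ Nat.card P ∣ e ∧ ∀ g : N, χ g ^ e = 1 := by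
  classical
  have := Fintype.ofFinite G
  let v (x : G) : k := if hx : x ∈ N then χ ⟨x, hx⟩ else 0
  have hvmul (g : N) (x : G) : v (g * x) = χ g * v x := by
    by_cases hx : x ∈ N
    · have hgx : (g : G) * x ∈ N := mul_mem g.2 hx
      simp only [v, hx, hgx, dif_pos]
      rw [← Units.val_mul, ← map_mul]
      rfl
    · have hgx : (g : G) * x ∉ N := fun h => hx ((Subgroup.mul_mem_cancel_left N g.2).1 h)
      simp [v, hx, hgx]
  have hv : v ≠ 0 := fun h0 => by
    have h1 := congrFun h0 1
    simp [v, N.one_mem] at h1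
  obtain ⟨f, hf, hfv⟩ := hd.exists_mem (translationRep k G) hv
  obtain ⟨Q, hQd, hQ⟩ := hf.1.1.exists_mvPolynomial
  let _ : MulAction G (G →₀ ℕ) :=
    { smul := fun g m => Finsupp.equivMapDomain (Equiv.mulLeft g) m
      one_smul := fun m => by ext x; exact congrArg m (show (1 : G)⁻¹ * x = x by simp)
      mul_smul := fun g h m => Finsupp.ext fun x => congrArg m
        (show (g * h)⁻¹ * x = h⁻¹ * (g⁻¹ * x) by simp [mul_assoc]) }
  have hsmul (g : G) (m : G →₀ ℕ) (x : G) : (g • m) x = m (g⁻¹ * x) := rfl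
  have hcoeff (g : G) (m : G →₀ ℕ) : Q.coeff (g • m) = Q.coeff m := by
    have hren : MvPolynomial.rename (g * ·) Q = Q := MvPolynomial.funext fun w => by
      rw [MvPolynomial.eval_rename, ← hQ, ← hQ,
        ← apply_eq_of_mem_invariantsLE hf.1 g⁻¹ w]
      congr 1
      ext x
      simp
    have hmap : g • m = Finsupp.mapDomain (g * ·) m := Finsupp.equivMapDomain_eq_mapDomain _ _
    conv_lhs => rw [← hren, hmap]
    exact MvPolynomial.coeff_rename_mapDomain _ (mul_right_injective g) _ _
  let deg (m : G →₀ ℕ) : ℕ := ∑ x, m x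
  have hdeg (g : G) (m : G →₀ ℕ) : deg (g • m) = deg m :=
    Equiv.sum_comp (Equiv.mulLeft g⁻¹) m
  let T (m : G →₀ ℕ) : k := Q.coeff m * ∏ x, v x ^ m x
  have hT (g : N) (m : G →₀ ℕ) : T ((g : G) • m) = χ g ^ deg m * T m := by
    simp only [T, hcoeff]
    rw [← Equiv.prod_comp (Equiv.mulLeft (g : G))]
    simp only [Equiv.coe_mulLeft, hsmul, inv_mul_cancel_left, hvmul, mul_pow,
      Finset.prod_mul_distrib, Finset.prod_pow_eq_pow_sum]
    simp only [deg]
    ring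
  have hsum : ∑ m ∈ Q.support, T m ≠ 0 := by
    rwa [← MvPolynomial.eval_eq', ← hQ]
  obtain ⟨e, hes⟩ : ∃ e, ∑ m ∈ Q.support.filter (fun m => deg m = e), T m ≠ 0 := by
    by_contra! hcon
    refine hsum ?_
    rw [← Finset.sum_fiberwise_of_maps_to
      (fun m hm => Finset.mem_image_of_mem deg hm) T]
    exact Finset.sum_eq_zero fun e _ => hcon e
  set M := Q.support.filter (fun m => deg m = e) with hM
  have hMsmul (g : G) (m : G →₀ ℕ) : g • m ∈ M ↔ m ∈ M := by
    simp [hM, MvPolynomial.mem_support_iff, hcoeff, hdeg]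
  have hMdeg {m : G →₀ ℕ} (hm : m ∈ M) : deg m = e := (Finset.mem_filter.1 hm).2
  refine ⟨e, Nat.pos_of_ne_zero ?_, ?_, ?_, fun g => ?_⟩
  · rintro rfl
    refine hes (Finset.sum_eq_zero fun m hm => ?_)
    have hm0 : m = 0 := by
      ext x
      exact Finset.sum_eq_zero_iff.1 (hMdeg hm) x (Finset.mem_univ x)
    have hc : Q.coeff 0 = 0 := by
      rw [← MvPolynomial.constantCoeff_eq, ← MvPolynomial.eval_zero, ← hQ]
      exact hf.2
    simp [T, hm0, hc]
  · obtain ⟨m, hm, -⟩ := Finset.exists_ne_zero_of_sum_ne_zero hes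
    refine le_trans ?_ hQd
    have := MvPolynomial.le_totalDegree (Finset.mem_filter.1 hm).1
    rwa [Finsupp.sum_fintype _ _ fun _ => rfl, show ∑ x, m x = e from hMdeg hm] at this
  · obtain ⟨m, hm, hfixed⟩ : ∃ m ∈ M, ∀ h : P, h • m = m := by
      by_contra! hcon
      refine hes (sum_eq_zero_of_forall_exists_smul_ne hP M T
        (fun h m hm => (hMsmul h m).2 hm) (fun h m _ => ?_) hcon)
      have := hT ⟨h, hPN h.2⟩ m
      rw [hχ h h.2, Units.val_one, one_pow, one_mul] at this
      exact this
    obtain ⟨R, hR, -⟩ := P.exists_isComplement_right 1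
    have := Fintype.ofFinite R
    have hconst (h : P) (x : G) : m (h * x) = m x := by
      have := DFunLike.congr_fun (hfixed h) (h * x)
      rw [← this]
      exact congrArg m (inv_mul_cancel_left _ _)
    refine ⟨∑ x : R, m x, ?_⟩
    rw [← hMdeg hm]
    simp only [deg]
    rw [← hR.sum_comp m, Fintype.sum_prod_type]
    simp [hconst, Nat.card_eq_fintype_card]
  · have hs : ∑ m ∈ M, T m = χ g ^ e * ∑ m ∈ M, T m := by
      conv_lhs => rw [← Finset.sum_equiv (MulAction.toPerm (g : G)) (s := M)
        (f := fun m => T ((g : G) • m)) (fun m => (hMsmul g m).symm) (fun m _ => rfl)]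
      rw [Finset.mul_sum]
      exact Finset.sum_congr rfl fun m hm => by rw [hT, hMdeg hm]
    ext
    rw [Units.val_pow_eq_pow_val, Units.val_one]
    exact mul_right_cancel₀ hes (by rw [one_mul]; exact hs.symm)

/-- If `P` is a normal `p`-subgroup of `N ≤ G` of index prime to `p` and `N / P` is cyclic, then
`|N| ≤ σ(G)`: apply `ZeroSeparates.exists_card_dvd` to a faithful character of `N / P`. -/
theorem ZeroSeparates.card_le_of_isCyclic [IsAlgClosed k] [Finite G] {p : ℕ} [Fact p.Prime]
    [CharP k p] {N P : Subgroup G} (hPN : P ≤ N) [(P.subgroupOf N).Normal] (hP : IsPGroup p P)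
    (hcop : ¬ p ∣ Nat.card (N ⧸ P.subgroupOf N)) [IsCyclic (N ⧸ P.subgroupOf N)] {d : ℕ}
    (hd : ZeroSeparates k G d) : Nat.card N ≤ d := by
  have := IsAlgClosed.instInfinite (K := k)
  set n := Nat.card (N ⧸ P.subgroupOf N) with hn
  have : NeZero (n : k) := ⟨fun h => hcop ((CharP.cast_eq_zero_iff k p n).1 h)⟩
  have : NeZero n := ⟨Nat.card_pos.ne'⟩
  obtain ⟨ζ, hζ⟩ := HasEnoughRootsOfUnity.exists_primitiveRoot k n
  obtain ⟨γ, hγ⟩ := IsCyclic.exists_generator (α := N ⧸ P.subgroupOf N)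
  have hγn : orderOf γ = n := orderOf_eq_card_of_forall_mem_zpowers hγ
  let ζ' : kˣ := (hζ.isUnit (NeZero.ne n)).unit
  have hζ' : orderOf ζ' = n := by
    rw [← orderOf_units]
    exact hζ.eq_orderOf.symm
  let ψ : N ⧸ P.subgroupOf N →* kˣ := monoidHomOfForallMemZpowers hγ (hζ'.trans hγn.symm).dvd
  obtain ⟨e, he0, hed, hPe, hχe⟩ := hd.exists_card_dvd hPN hP (ψ.comp (QuotientGroup.mk' _))
    fun h hh => by
      have : (QuotientGroup.mk' (P.subgroupOf N)) ⟨h, hPN hh⟩ = 1 :=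
        (QuotientGroup.eq_one_iff _).2 (Subgroup.mem_subgroupOf.2 hh)
      rw [MonoidHom.comp_apply, this, map_one]
  have hne : n ∣ e := by
    obtain ⟨g, hg⟩ := QuotientGroup.mk'_surjective _ γ
    have := hχe g
    rw [MonoidHom.comp_apply, hg, monoidHomOfForallMemZpowers_apply_gen] at this
    exact hζ' ▸ orderOf_dvd_of_pow_eq_one this
  obtain ⟨j, hj⟩ := IsPGroup.iff_card.1 hP
  have hcop' : n.Coprime (Nat.card P) := by
    rw [hj]
    exact Nat.Coprime.pow_right j (((Nat.Prime.coprime_iff_not_dvd Fact.out).2 hcop).symm)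
  refine le_trans (Nat.le_of_dvd he0 ?_) hed
  rw [(P.subgroupOf N).card_eq_card_quotient_mul_card_subgroup,
    Nat.card_congr (Subgroup.subgroupOfEquivOfLe hPN).toEquiv]
  exact hcop'.mul_dvd_of_dvd_of_dvd hne hPe

end LowerBound

/-! ### Normalizers of Sylow subgroups and normal complements -/

section Sylow

theorem natCast_ne_zero_of_not_dvd {k : Type*} [Field k] {p : ℕ} [CharP k p] {n : ℕ}
    (h : ¬ p ∣ n) : (n : k) ≠ 0 := fun h0 => h ((CharP.cast_eq_zero_iff k p n).1 h0)

variable {k G : Type*} [Field k] [IsAlgClosed k] [Group G] [Finite G]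

theorem SavesPrime.sigma_le {l : ℕ} (hl : IsLeast {q : ℕ | q.Prime ∧ q ∣ Nat.card G} l)
    (h : SavesPrime k G) : sigma k G ≤ ((Nat.card G / l : ℕ) : ℕ∞) := by
  have := IsAlgClosed.instInfinite (K := k)
  obtain ⟨r, d, hr, hrG, hd, hle⟩ := h
  refine sigma_le_iff.2 (hd.mono ((Nat.le_div_iff_mul_le hl.1.1.pos).2 ?_))
  exact (Nat.mul_le_mul_left d (hl.2 ⟨hr, hrG⟩)).trans hle

theorem SavesPrime.sigma_ne_card (h : SavesPrime k G) : sigma k G ≠ (Nat.card G : ℕ∞) := by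
  have := IsAlgClosed.instInfinite (K := k)
  obtain ⟨r, d, hr, hrG, hd, hle⟩ := h
  intro heq
  have h1 := sigma_le_iff.2 hd
  rw [heq, Nat.cast_le] at h1
  have h2 : 0 < Nat.card G := Nat.card_pos
  have := hr.two_le
  nlinarith

variable {p : ℕ} [Fact p.Prime] [CharP k p]

theorem not_dvd_card_normalizerQuotient (P : Sylow p G) :
    ¬ p ∣ Nat.card (NormalizerQuotient (P : Subgroup G)) := fun h =>
  P.not_dvd_index (h.trans (Subgroup.relIndex_dvd_index_of_le Subgroup.le_normalizer))

theorem isCyclic_normalizerQuotient_of_sigma_eq (P : Sylow p G)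
    (h : sigma k G = (Nat.card G : ℕ∞)) : IsCyclic (NormalizerQuotient (P : Subgroup G)) := by
  by_contra hcyc
  refine SavesPrime.sigma_ne_card (k := k) (SavesPrime.of_subgroup _ (SavesPrime.of_quotient _
    (savesPrime_of_not_isCyclic (natCast_ne_zero_of_not_dvd
      (not_dvd_card_normalizerQuotient P)) hcyc))) h

/-- A normal complement `H` of a non-normal Sylow `p`-subgroup is either not cyclic, so that
already `r σ(H) ≤ |H|` for a prime `r`, or cyclic and not centralized by the Sylow subgroup. -/
theorem savesPrime_of_isPNilpotent (hG : IsPNilpotent p G) {P : Sylow p G}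
    (hP : ¬ (P : Subgroup G).Normal) : SavesPrime k G := by
  obtain ⟨P', H, hH, hc⟩ := hG
  have hP' : ¬ (P' : Subgroup G).Normal := fun h => hP (by
    have := P'.unique_of_normal h
    rwa [Subsingleton.elim P P'])
  have hpH : ¬ p ∣ Nat.card H := by
    rw [← hc.index_eq_card]
    exact P'.not_dvd_index
  have hHk : (Nat.card H : k) ≠ 0 := natCast_ne_zero_of_not_dvd hpH
  by_cases hcyc : IsCyclic H
  · obtain ⟨x, hx, h, hh, hne⟩ : ∃ x ∈ P', ∃ h ∈ H, x * h ≠ h * x := by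
      by_contra! hcomm
      refine hP' ⟨fun y hy g => ?_⟩
      obtain ⟨⟨h, z⟩, rfl⟩ := hc.2 g
      have h1 : (z : G) * y * (z : G)⁻¹ ∈ (P' : Subgroup G) :=
        mul_mem (mul_mem z.2 hy) (inv_mem z.2)
      have h2 := hcomm _ h1 h h.2
      have h3 : (h : G) * z * y * ((h : G) * z)⁻¹ = z * y * (z : G)⁻¹ := by
        calc (h : G) * z * y * ((h : G) * z)⁻¹ = h * (z * y * (z : G)⁻¹) * (h : G)⁻¹ := by group
          _ = _ := by rw [← h2, mul_inv_cancel_right]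
      exact h3 ▸ h1
    have hcop : (Nat.card H).Coprime (orderOf x) := by
      obtain ⟨j, hj⟩ := P'.isPGroup'.exists_orderOf_eq_pow ⟨x, hx⟩
      rw [← Subgroup.orderOf_mk x hx, hj]
      exact Nat.Coprime.pow_right j (((Nat.Prime.coprime_iff_not_dvd Fact.out).2 hpH).symm)
    obtain ⟨a, ha, hprime, hne⟩ := exists_prime_orderOf_not_commute hcop ⟨h, hh, hne⟩
    refine savesPrime_of_conj_mem_zpowers hprime (natCast_ne_zero_of_not_dvd (p := p) fun hdvd =>
      hpH (hdvd.trans ?_)) rfl (conj_mem_zpowers_of_isCyclic ha x) hne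
    simpa using orderOf_dvd_natCard (⟨a, ha⟩ : H)
  · exact SavesPrime.of_subgroup H (savesPrime_of_not_isCyclic hHk hcyc)

end Sylow

end ZeroSep

theorem theorem1p2 {k : Type*} [Field k] [IsAlgClosed k] {G : Type*} [Group G] [Finite G]
    (p : ℕ) [CharP k p] (hp : p.Prime) (hpG : p ∣ Nat.card G) (P : Sylow p G)
    (l : ℕ) (hl : IsLeast {q : ℕ | q.Prime ∧ q ∣ Nat.card G} l) :
    -- (a)
    (ZeroSep.sigma k G = (Nat.card G : ℕ∞) →
      IsCyclic (ZeroSep.NormalizerQuotient (P : Subgroup G)) ∧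
      ((∀ x ∈ P, ∀ y ∈ P, x * y = y * x) → (P : Subgroup G) ≠ ⊤ →
        Nontrivial (ZeroSep.NormalizerQuotient (P : Subgroup G)))) ∧
    -- (b)
    (IsCyclic (ZeroSep.NormalizerQuotient (P : Subgroup G)) →
      (Nat.card (Subgroup.normalizer ((P : Subgroup G) : Set G)) : ℕ∞) ≤ ZeroSep.sigma k G) ∧
    (∀ [(P : Subgroup G).Normal], IsCyclic (G ⧸ (P : Subgroup G)) →
      ZeroSep.sigma k G = (Nat.card G : ℕ∞)) ∧
    -- (c)
    (ZeroSep.IsPNilpotent p G → ¬ (P : Subgroup G).Normal →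
      ZeroSep.sigma k G ≤ ((Nat.card G / l : ℕ) : ℕ∞)) := by
  have := Fact.mk hp
  have := IsAlgClosed.instInfinite (K := k)
  have hnoether : ZeroSep.sigma k G ≤ Nat.card G :=
    ZeroSep.sigma_le_iff.2 ZeroSep.zeroSeparates_card
  have hb : IsCyclic (ZeroSep.NormalizerQuotient (P : Subgroup G)) →
      (Nat.card (Subgroup.normalizer ((P : Subgroup G) : Set G)) : ℕ∞) ≤ ZeroSep.sigma k G := by
    intro hcyc
    obtain ⟨d, hd⟩ := ENat.ne_top_iff_exists.1
      (ne_top_of_le_ne_top (ENat.natCast_ne_top _) hnoether)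
    rw [← hd, Nat.cast_le]
    exact (ZeroSep.sigma_le_iff.1 hd.symm.le).card_le_of_isCyclic Subgroup.le_normalizer
      P.isPGroup' (ZeroSep.not_dvd_card_normalizerQuotient P)
  refine ⟨fun h => ⟨ZeroSep.isCyclic_normalizerQuotient_of_sigma_eq P h, fun hcomm hne => ?_⟩, hb,
    fun {hN} hcyc => hnoether.antisymm ?_, fun hG hP =>
      (ZeroSep.savesPrime_of_isPNilpotent hG hP).sigma_le hl⟩
  · -- if `P` is abelian and self-normalizing, then `G` is `p`-nilpotent by Burnside's theorem
    by_contra htriv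
    rw [not_nontrivial_iff_subsingleton, QuotientGroup.subsingleton_iff,
      Subgroup.subgroupOf_eq_top] at htriv
    have hnil : ZeroSep.IsPNilpotent p G := by
      refine ⟨P, _, inferInstance, MonoidHom.ker_transferSylow_isComplement' P
        (htriv.trans fun x hx => Subgroup.mem_centralizer_iff.2 fun y hy => hcomm y hy x hx)⟩
    have hnot : ¬ (P : Subgroup G).Normal := fun hN => hne (by
      rwa [Subgroup.normalizer_eq_top_iff.2 hN, top_le_iff] at htriv)
    exact (ZeroSep.savesPrime_of_isPNilpotent (k := k) hnil hnot).sigma_ne_card h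
  · have htop : Subgroup.normalizer ((P : Subgroup G) : Set G) = ⊤ :=
      Subgroup.normalizer_eq_top_iff.2 hN
    have hcyc' : IsCyclic (ZeroSep.NormalizerQuotient (P : Subgroup G)) := by
      let ι : Subgroup.normalizer ((P : Subgroup G) : Set G) →* G := Subgroup.subtype _
      let φ : ZeroSep.NormalizerQuotient (P : Subgroup G) →* G ⧸ (P : Subgroup G) :=
        QuotientGroup.map _ _ ι le_rfl
      refine isCyclic_of_injective φ ((injective_iff_map_eq_one φ).2 fun c hc => ?_)
      obtain ⟨x, rfl⟩ := QuotientGroup.mk_surjective c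
      exact (QuotientGroup.eq_one_iff x).2
        (Subgroup.mem_subgroupOf.2 ((QuotientGroup.eq_one_iff (x : G)).1 hc))
    have := hb hcyc'
    rwa [htop, Subgroup.card_top] at this
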